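/- Let $\mathcal D=C_0^\infty(\mathbb R,\mathbb C)$ with dual space of distributions $\mathcal D'$, let $\mathcal S'$ be the space of tempered distributions, and for $f\in L^1_{\rm loc}(\mathbb R,\mathbb C)$ let $\iota f\in\mathcal D'$ be given by $\langle \iota f,\varphi\rangle=\int_{\mathbb R} f\varphi$. Let $S=Z*$ be the convolution operator with defining distribution $Z\in\mathcal D'$, its domain being the set of all $U\in\mathcal D'$ for which the convolution $Z*U$ exists. Here $Z*U$ exists and is equal to $T\in\mathcal D'$ if for every $\varphi\in\mathcal D$ and every sequence $\chi_k\in C_0^\infty(\mathbb R^2,\mathbb C)$ that is eventually equal to $1$ on each compact set and has each derivative bounded uniformly in $k$ and on $\mathbb R^2$, one has $\langle Z\otimes U,\ \chi_k(t_1,t_2)\varphi(t_1+t_2)\rangle\to\langle T,\varphi\rangle$ as $k\to\infty$. Let $\delta_{0j}$ be the Kronecker symbol. Let $N\in\mathbb N_0$ and $F,G\in\mathbb R^{N+1}$, and suppose that $S$ is a scattering pseudo-passive causal operator of slow growth with data $N,F,G$, that is: (a) for every $\zeta\in\mathcal D$ there is $\eta\in\mathcal D$ with $S(\iota\zeta)=\iota\eta$,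 and for every $t\in\mathbb R$ $$\sum_{j=0}^N\int_{-\infty}^t\Big((\delta_{0j}-F_j)|\zeta^{(j)}(\tau)|^2-(\delta_{0j}+F_j)|\eta^{(j)}(\tau)|^2\Big)\,d\tau\ \ge\ 2\sum_{j=0}^N G_j\,\mathrm{Re}\int_{-\infty}^t\overline{\zeta^{(j)}(\tau)}\,\eta^{(j)}(\tau)\,d\tau;$$ (b) $\mathrm{supp}\,Z\subseteq[0,\infty)$; (c) $Z\in\mathcal S'$. For a distribution $U$ with support bounded on the left, the Laplace transform at $s\in\mathbb C$ is defined, whenever $e^{-c\tau}U\in\mathcal S'$ for some real $c<\mathrm{Re}\,s$, by $\mathcal L(U)(s)=\langle e^{-c\tau}U,\ \rho(\xi)e^{-(s-c)\xi}\rangle$, where $\rho$ is any smooth function with support bounded on the left that is equal to $1$ on a neighbourhood of $\mathrm{supp}\,U$ and for which $\rho(\xi)e^{-(s-c)\xi}$ is a Schwartz function; the value does not depend on $c$ and $\rho$. Then the Laplace transform $W(s)=\mathcal L(Z)(s)$ exists for every $s\in\mathbb C_+=\{s\in\mathbb C:\mathrm{Re}\,s>0\}$, $W$ is holomorphic on $\mathbb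 C_+$, and for every $s\in\mathbb C_+$ $$\sum_{j=0}^N|s|^{2j}\Big((\delta_{0j}-F_j)-(\delta_{0j}+F_j)|W(s)|^2\Big)\ \ge\ 2\sum_{j=0}^N G_j|s|^{2j}\,\mathrm{Re}\,W(s).$$ Furthermore, if $S$ is real, i.e. maps real distributions of its domain to real distributions (a distribution is real if it takes real values on real-valued test functions), then $W(s)\in\mathbb R$ for all $s\in(0,\infty)$. -/

import Mathlib

open Filter Topology MeasureTheory TopologicalSpace
open scoped Distributions SchwartzMap ContDiff ComplexConjugate

noncomputable section

namespace ScatteringOperators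

/-- The space `𝓓 = C_0^∞(ℝ, ℂ)` of complex-valued test functions on the line. -/
abbrev TestFn : Type := 𝓓((⊤ : Opens ℝ), ℂ)

/-- The space `𝓓'` of distributions: continuous complex-linear functionals on `𝓓`. -/
abbrev Distrib : Type := TestFn →L[ℂ] ℂ

open Classical in
/-- The action `⟨U, f⟩` of a distribution on an unbundled function `f`. This is `U f` when `f` is a
test function (smooth with compact support). In all uses below `f` is a test function; the value
`0` for other `f` is only a convention. -/
def pairing (U : Distrib) (f : ℝ → ℂ) : ℂ :=
  if h : ContDiff ℝ ∞ f ∧ HasCompactSupport f then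
    U ⟨f, h.1, h.2, fun _ _ => trivial⟩
  else 0

/-- The inclusion `ι : L¹_loc → 𝓓'`, `⟨ι f, φ⟩ = ∫ f φ` (and `ι f = 0` by convention when `f` is not
locally integrable). -/
def iota (f : ℝ → ℂ) : Distrib :=
  TestFunction.integralAgainstBilinCLM (ContinuousLinearMap.mul ℂ ℂ) volume f

/-- The support of a distribution: the points in no neighbourhood of which `U` is zero. -/
def supp (U : Distrib) : Set ℝ := Distribution.dsupport (fun φ : TestFn => U φ)

/-- `U` is real: `⟨U, φ⟩` is real for every real-valued test function `φ`. -/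
def IsRealDistrib (U : Distrib) : Prop :=
  ∀ φ : TestFn, (∀ x, (φ x).im = 0) → (U φ).im = 0

/-- The direct product `⟨V ⊗ U, ψ⟩ = ⟨V, t₁ ↦ ⟨U, t₂ ↦ ψ (t₁, t₂)⟩⟩`, for a test function `ψ` in two
variables. For such `ψ` the inner function of `t₁` is itself a test function. -/
def directProduct (V U : Distrib) (ψ : ℝ × ℝ → ℂ) : ℂ :=
  pairing V (fun t₁ => pairing U (fun t₂ => ψ (t₁, t₂)))

/-- A sequence of test functions in two variables that converges to `1` on the plane: on each
compact set it is eventually equal to `1`, and each derivative is bounded uniformly in the sequence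
and on the plane. -/
structure TendsToOne (χ : ℕ → 𝓓((⊤ : Opens (ℝ × ℝ)), ℂ)) : Prop where
  eventually_one : ∀ K : Set (ℝ × ℝ), IsCompact K → ∀ᶠ k in atTop, ∀ p ∈ K, χ k p = 1
  bounded : ∀ m : ℕ, ∃ C : ℝ, ∀ (k : ℕ) (p : ℝ × ℝ), ‖iteratedFDeriv ℝ m (χ k) p‖ ≤ C

/-- `IsConvolution V U T`: the convolution `V * U` exists and equals `T`, i.e.
`⟨T, φ⟩ = ⟨V ⊗ U, (t₁, t₂) ↦ φ (t₁ + t₂)⟩` for every test function `φ`. As `φ (t₁ + t₂)` is not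
compactly supported, the right-hand side is the limit of `⟨V ⊗ U, χ_k (t₁, t₂) φ (t₁ + t₂)⟩`, which
has to exist and be the same for all sequences `χ_k` of test functions converging to `1`. -/
def IsConvolution (V U T : Distrib) : Prop :=
  ∀ (φ : TestFn) (χ : ℕ → 𝓓((⊤ : Opens (ℝ × ℝ)), ℂ)), TendsToOne χ →
    Tendsto (fun k => directProduct V U (fun p => χ k p * φ (p.1 + p.2))) atTop (𝓝 (T φ))

/-- The convolution operator `Z *`, with domain all `U` for which `Z * U` exists, is real: it maps
real distributions of its domain to real distributions. -/
def IsRealOperator (Z : Distrib) : Prop :=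
  ∀ U T : Distrib, IsConvolution Z U T → IsRealDistrib U → IsRealDistrib T

/-- Causality: `supp Z ⊆ [0, ∞)`. -/
def IsCausal (Z : Distrib) : Prop := supp Z ⊆ Set.Ici 0

/-- The tempered distribution `T` is the extension of `e^{-cτ} U` from `𝓓` to `𝓢`. -/
def ExtendsExpMul (U : Distrib) (c : ℝ) (T : 𝓢'(ℝ, ℂ)) : Prop :=
  ∀ (φ : TestFn) (g : 𝓢(ℝ, ℂ)), (∀ x, g x = φ x) →
    T g = pairing U (fun τ => (Real.exp (-(c * τ)) : ℂ) * φ τ)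

/-- Slow growth: `Z ∈ 𝓢'`, i.e. `Z` is the restriction to `𝓓` of a tempered distribution. -/
def HasSlowGrowth (Z : Distrib) : Prop :=
  ∃ T : 𝓢'(ℝ, ℂ), ∀ (φ : TestFn) (g : 𝓢(ℝ, ℂ)), (∀ x, g x = φ x) → T g = Z φ

/-- The Kronecker symbol `δ_{0,j}`. -/
def kron (j : ℕ) : ℝ := if j = 0 then 1 else 0

/-- Scattering pseudo-passivity of `Z *` on `ι(𝓓)` with data `N, F, G`: for each test function `ζ`
one has `Z * ι ζ = ι η` for some test function `η`, and the energy inequality holds up to every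
time `t`. -/
def IsScatteringPseudoPassive (Z : Distrib) (N : ℕ) (F G : Fin (N + 1) → ℝ) : Prop :=
  ∀ ζ : TestFn, ∃ η : TestFn, IsConvolution Z (iota ζ) (iota η) ∧ ∀ t : ℝ,
    ∑ j : Fin (N + 1), ∫ τ in Set.Iic t,
        ((kron j - F j) * ‖iteratedDeriv j ζ τ‖ ^ 2 - (kron j + F j) * ‖iteratedDeriv j η τ‖ ^ 2)
      ≥ 2 * ∑ j : Fin (N + 1),
          G j * (∫ τ in Set.Iic t, conj (iteratedDeriv j ζ τ) * iteratedDeriv j η τ).re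

/-- `Z *` is a scattering pseudo-passive causal operator of slow growth, the pseudo-passivity
inequality being satisfied with the data `N, F, G`. -/
structure IsScatteringPseudoPassiveCausalSlowGrowth (Z : Distrib) (N : ℕ) (F G : Fin (N + 1) → ℝ) :
    Prop where
  pseudoPassive : IsScatteringPseudoPassive Z N F G
  causal : IsCausal Z
  slowGrowth : HasSlowGrowth Z

/-- The auxiliary data that evaluate the Laplace transform of `U` at `s`: a number `c < Re s`, the
tempered distribution `T = e^{-cτ} U`, a smooth `ρ` with support bounded on the left and equal to
`1` on a neighbourhood of `supp U`, and the Schwartz function `g ξ = ρ ξ * e^{-(s - c) ξ}`. -/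
structure IsLaplaceDatum (U : Distrib) (s : ℂ) (c : ℝ) (T : 𝓢'(ℝ, ℂ)) (ρ : ℝ → ℂ)
    (g : 𝓢(ℝ, ℂ)) : Prop where
  lt_re : c < s.re
  extends_exp : ExtendsExpMul U c T
  smooth : ContDiff ℝ ∞ ρ
  supp_bddBelow : BddBelow (Function.support ρ)
  eq_one : ∀ᶠ ξ in 𝓝ˢ (supp U), ρ ξ = 1
  eq_mul_exp : ∀ ξ : ℝ, g ξ = ρ ξ * Complex.exp (-(s - c) * ξ)

/-- The Laplace transform of `U` at `s` exists and equals `w`: `U` is right-sided, there are data as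
above, and `⟨e^{-cτ} U, ρ ξ * e^{-(s - c) ξ}⟩ = w` for all of them. -/
structure HasLaplaceTransformAt (U : Distrib) (s w : ℂ) : Prop where
  rightSided : ∃ t : ℝ, supp U ⊆ Set.Ici t
  exists_datum : ∃ c T ρ g, IsLaplaceDatum U s c T ρ g
  eq_value : ∀ c T ρ g, IsLaplaceDatum U s c T ρ g → T g = w

/-- The open right half-plane. -/
def rightHalfPlane : Set ℂ := {s | 0 < s.re}

end ScatteringOperators

end

/-!
Everything follows from pairs of test functions `ζ`, `η` with `Z * ζ = η`. Since `η` has compact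
support, such a pair determines the Laplace transform of `Z` wherever `ℒζ` does not vanish: for
every `s` one has `W(s) ℒζ(s) = ℒη(s)` (`IsLaplaceDatum.apply_mul_laplace`). To see this, write the
convolution in transposed form, `⟨Z, ζ̌ * φ⟩ = ∫ η φ` with `ζ̌(t) = ζ(-t)`
(`IsConvolution.apply_crossCorr_iota`), and insert `φ(t) = θ(rt) e^{-st}` with a cutoff `θ`; as
`r → 0`, the left-hand side converges because `e^{-ct} Z` is a continuous functional on the Schwartz
space (`tendsto_zero_of_linear_growth`) and `Z` only sees a neighbourhood of its support
(`apply_eq_zero_of_eventually_supp`). The identity shows that the value of the Laplace transform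
does not depend on the data used to evaluate it. With an input `ζ` such that `ℒζ(s) ≠ 0`, for
example a bump function times an exponential, it also shows that `W = ℒη / ℒζ` is holomorphic near
`s`, and that `W(s)` is real if `s`, `ζ` and `η` are.

For the energy inequality, `Z *` commutes with convolutions, so it maps `ζ * a` to `η * a` for
every test function `a` (`IsConvolution.eq_conv`). Let `a` be equal to `e^{sτ}` between a fixed
time and a time beyond `t`. Because `ζ` and `η` have compact support, `ζ * a` and `η * a` are
exactly `ℒζ(s) e^{sτ}` and `ℒη(s) e^{sτ}` between some fixed time and `t`. The energy up to time
`t` is then a constant plus the quadratic form of the theorem, evaluated at the amplitudes `ℒζ(s)`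
and `ℒη(s)`, times `∫ e^{2 Re(s) τ} dτ`. Letting `t → ∞` shows that the form is nonnegative
(`energyForm_laplace_nonneg`), and dividing by `|ℒζ(s)|²` gives the inequality for `W(s)`.
-/

noncomputable section

namespace ScatteringOperators

/-! ### Test functions and their cross-correlations -/

/-- The test function with underlying function `f`. -/
def mkTest (f : ℝ → ℂ) (hf : ContDiff ℝ ∞ f) (hc : HasCompactSupport f) : TestFn :=
  ⟨f, hf, hc, fun _ _ => trivial⟩

@[simp] lemma mkTest_apply (f : ℝ → ℂ) (hf : ContDiff ℝ ∞ f) (hc : HasCompactSupport f) (x : ℝ) :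
    mkTest f hf hc x = f x := rfl

lemma testFn_contDiff (φ : TestFn) : ContDiff ℝ ∞ φ := φ.contDiff'

lemma testFn_continuous (φ : TestFn) : Continuous φ := (testFn_contDiff φ).continuous

lemma testFn_hasCompactSupport (φ : TestFn) : HasCompactSupport φ := φ.hasCompactSupport'

lemma testFn_integrable (φ : TestFn) : Integrable φ :=
  (testFn_continuous φ).integrable_of_hasCompactSupport (testFn_hasCompactSupport φ)

lemma pairing_of_testFn (U : Distrib) (f : ℝ → ℂ) (φ : TestFn) (h : ∀ x, f x = φ x) :
    pairing U f = U φ := by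
  obtain rfl : f = φ := funext h
  exact dif_pos ⟨testFn_contDiff φ, testFn_hasCompactSupport φ⟩

lemma iota_apply (ζ φ : TestFn) : iota ζ φ = ∫ x, φ x * ζ x := by
  unfold iota
  rw [TestFunction.integralAgainstBilinCLM_eq_integral
    ((testFn_continuous ζ).locallyIntegrable.locallyIntegrableOn _)]
  simp

lemma exists_testFn_bound (φ : TestFn) : ∃ M : ℝ, 0 < M ∧ ∀ x, M < |x| → φ x = 0 := by
  obtain ⟨R, hR⟩ := (testFn_hasCompactSupport φ).isCompact.isBounded.subset_closedBall (0 : ℝ)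
  refine ⟨max R 1, by positivity, fun x hx => image_eq_zero_of_notMem_tsupport fun h => ?_⟩
  have := hR h
  rw [mem_closedBall_zero_iff, Real.norm_eq_abs] at this
  exact absurd (lt_of_le_of_lt (le_max_left _ _) hx) (not_lt.2 this)

lemma correlation_eq_convolution (f φ : TestFn) :
    (fun t => ∫ u, f u * φ (t + u)) =
      convolution (f ∘ Homeomorph.neg ℝ) φ (ContinuousLinearMap.mul ℝ ℂ) volume := by
  funext t
  rw [convolution_def, ← integral_neg_eq_self]
  simp [sub_eq_add_neg]

/-- The cross-correlation `t ↦ ∫ f u * φ (t + u) du` of two test functions. As a function of `φ` it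
is the transpose of the convolution by `f`. -/
def crossCorr (f φ : TestFn) : TestFn :=
  mkTest (fun t => ∫ u, f u * φ (t + u))
    (by
      rw [correlation_eq_convolution]
      exact (testFn_hasCompactSupport φ).contDiff_convolution_right (n := ⊤) _
        ((testFn_continuous f).comp continuous_neg).locallyIntegrable (testFn_contDiff φ))
    (by
      rw [correlation_eq_convolution]
      exact ((testFn_hasCompactSupport f).comp_homeomorph (Homeomorph.neg ℝ)).convolution _
        (testFn_hasCompactSupport φ))

@[simp] lemma crossCorr_apply (f φ : TestFn) (t : ℝ) :
    crossCorr f φ t = ∫ u, f u * φ (t + u) := rfl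

/-- The convolution `t ↦ ∫ f u * a (t - u) du` of two test functions. -/
def conv (f a : TestFn) : TestFn :=
  mkTest (fun t => ∫ u, f u * a (t - u))
    (by
      exact (testFn_hasCompactSupport a).contDiff_convolution_right (n := ⊤)
        (ContinuousLinearMap.mul ℝ ℂ) (f := f) (μ := volume)
        (testFn_continuous f).locallyIntegrable (testFn_contDiff a))
    ((testFn_hasCompactSupport f).convolution
        (ContinuousLinearMap.mul ℝ ℂ) (μ := volume) (testFn_hasCompactSupport a))

@[simp] lemma conv_apply (f a : TestFn) (t : ℝ) :
    conv f a t = ∫ u, f u * a (t - u) := rfl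

lemma crossCorr_conv (f a φ : TestFn) :
    crossCorr (conv f a) φ = crossCorr f (crossCorr a φ) := by
  ext t
  have hcont : Continuous (Function.uncurry fun v u : ℝ => f u * a (v - u) * φ (t + v)) :=
    (((testFn_continuous f).comp continuous_snd).mul
      ((testFn_continuous a).comp (continuous_fst.sub continuous_snd))).mul
      ((testFn_continuous φ).comp (continuous_const.add continuous_fst))
  have hcomp : HasCompactSupport
      (Function.uncurry fun v u : ℝ => f u * a (v - u) * φ (t + v)) := by
    obtain ⟨A, -, hA⟩ := exists_testFn_bound f
    obtain ⟨B, -, hB⟩ := exists_testFn_bound φ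
    refine HasCompactSupport.intro
      ((isCompact_Icc (a := -B - t) (b := B - t)).prod (isCompact_Icc (a := -A) (b := A))) ?_
    rintro ⟨v, u⟩ hp
    simp only [Function.uncurry_apply_pair]
    by_cases hu : A < |u|
    · simp [hA u hu]
    by_cases hv : B < |t + v|
    · simp [hB _ hv]
    rw [not_lt, abs_le] at hu hv
    exact absurd ⟨⟨by linarith, by linarith⟩, hu⟩ hp
  calc crossCorr (conv f a) φ t = ∫ v, ∫ u, f u * a (v - u) * φ (t + v) := by
        simp only [crossCorr_apply, conv_apply, integral_mul_const]
    _ = ∫ u, ∫ v, f u * a (v - u) * φ (t + v) :=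
        integral_integral_swap_of_hasCompactSupport hcont hcomp
    _ = crossCorr f (crossCorr a φ) t := by
        simp only [crossCorr_apply, ← integral_const_mul]
        congr 1; ext u
        rw [← integral_add_right_eq_self _ u]
        congr 1; ext w
        simp only [add_sub_cancel_right, mul_assoc]
        congr 3; ring

lemma integral_mul_eq_crossCorr (f φ : TestFn) : ∫ x, f x * φ x = crossCorr f φ 0 := by simp

lemma testFn_eq_of_integral_eq (f g : TestFn)
    (h : ∀ φ : TestFn, ∫ x, f x * φ x = ∫ x, g x * φ x) : f = g := by
  have hae := ae_eq_of_integral_contDiff_smul_eq (μ := (volume : Measure ℝ))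
    (testFn_continuous f).locallyIntegrable (testFn_continuous g).locallyIntegrable
    (fun q hq hqc => by
      have h1 : ContDiff ℝ ∞ fun x => (q x : ℂ) := Complex.ofRealCLM.contDiff.comp hq
      have h2 : HasCompactSupport fun x => (q x : ℂ) := hqc.comp_left Complex.ofReal_zero
      have := h (mkTest _ h1 h2)
      simp only [mkTest_apply] at this
      simpa only [Complex.real_smul, mul_comm] using this)
  ext x
  exact congrFun (((testFn_continuous f).ae_eq_iff_eq _ (testFn_continuous g)).1 hae) x

/-! ### Convolution operators on test functions -/

/-- Dilations of a bump function on the plane that equals `1` on the unit ball. -/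
lemma exists_tendsToOne : ∃ χ : ℕ → 𝓓((⊤ : Opens (ℝ × ℝ)), ℂ), TendsToOne χ := by
  let b : ContDiffBump (0 : ℝ × ℝ) := ⟨1, 2, one_pos, one_lt_two⟩
  let θ : ℝ × ℝ → ℂ := fun p => (b p : ℂ)
  have hθ : ContDiff ℝ ∞ θ := Complex.ofRealCLM.contDiff.comp b.contDiff
  have hθc : HasCompactSupport θ := b.hasCompactSupport.comp_left Complex.ofReal_zero
  let r : ℕ → ℝ := fun k => ((k : ℝ) + 1)⁻¹
  have hr : ∀ k, 0 < r k := fun k => by positivity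
  have hr1 : ∀ k, r k ≤ 1 := fun k => inv_le_one_of_one_le₀ (by simp)
  let χ : ℕ → 𝓓((⊤ : Opens (ℝ × ℝ)), ℂ) := fun k =>
    ⟨fun p => θ (r k • p), hθ.comp (contDiff_const_smul (r k)),
      hθc.comp_smul (hr k).ne', fun _ _ => trivial⟩
  refine ⟨χ, ⟨fun K hK => ?_, fun m => ?_⟩⟩
  · obtain ⟨R, hR⟩ := hK.isBounded.subset_closedBall (0 : ℝ × ℝ)
    filter_upwards [eventually_ge_atTop ⌈R⌉₊] with k hk p hp
    have h1 : ‖p‖ ≤ R := by simpa using hR hp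
    have h2 : R ≤ k := Nat.ceil_le.1 hk
    have : b (r k • p) = 1 := by
      apply b.one_of_mem_closedBall
      rw [mem_closedBall_zero_iff, norm_smul, Real.norm_of_nonneg (hr k).le]
      change ((k : ℝ) + 1)⁻¹ * ‖p‖ ≤ 1
      rw [inv_mul_le_iff₀ (by positivity)]
      linarith
    change ((b (r k • p) : ℝ) : ℂ) = 1
    rw [this, Complex.ofReal_one]
  · obtain ⟨C, hC⟩ := (hθc.iteratedFDeriv (𝕜 := ℝ) m).exists_bound_of_continuous
      (hθ.continuous_iteratedFDeriv (by exact_mod_cast le_top))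
    refine ⟨C, fun k p => ?_⟩
    have : iteratedFDeriv ℝ m (χ k) = fun p => r k ^ m • iteratedFDeriv ℝ m θ (r k • p) :=
      iteratedFDeriv_comp_const_smul (r k) (hθ.of_le (by exact_mod_cast le_top))
    rw [this, norm_smul, norm_pow, Real.norm_of_nonneg (hr k).le]
    exact (mul_le_of_le_one_left (norm_nonneg _) (pow_le_one₀ (hr k).le (hr1 k))).trans (hC _)

/-- On test functions the convolution operator `Z *` is the transpose of the cross-correlation:
the cutoffs in the definition of the convolution play no role once they equal `1` on a
sufficiently large square. -/
lemma IsConvolution.apply_crossCorr {Z T : Distrib} {ζ : TestFn}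
    (h : IsConvolution Z (iota ζ) T) (φ : TestFn) : Z (crossCorr ζ φ) = T φ := by
  obtain ⟨χ, hχ⟩ := exists_tendsToOne
  refine tendsto_nhds_unique (tendsto_const_nhds.congr' ?_) (h φ χ hχ)
  obtain ⟨A, -, hA⟩ := exists_testFn_bound ζ
  obtain ⟨B, -, hB⟩ := exists_testFn_bound φ
  filter_upwards [hχ.eventually_one (Set.Icc (-(A + B)) (A + B) ×ˢ Set.Icc (-A) A)
    (isCompact_Icc.prod isCompact_Icc)] with k hk
  refine (pairing_of_testFn _ _ _ fun t => ?_).symm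
  have hin : ContDiff ℝ ∞ fun u => χ k (t, u) * φ (t + u) :=
    ((χ k).contDiff'.comp (contDiff_const.prodMk contDiff_id)).mul
      ((testFn_contDiff φ).comp (contDiff_const.add contDiff_id))
  have hinc : HasCompactSupport fun u => χ k (t, u) * φ (t + u) :=
    ((testFn_hasCompactSupport φ).comp_homeomorph (Homeomorph.addLeft t)).mul_left
  refine (pairing_of_testFn _ _ (mkTest _ hin hinc) fun u => rfl).trans ?_
  rw [iota_apply, crossCorr_apply]
  congr 1; ext u
  rw [mkTest_apply]
  by_cases hu : A < |u|
  · simp [hA u hu]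
  by_cases hv : B < |t + u|
  · simp [hB _ hv]
  rw [not_lt, abs_le] at hu hv
  rw [hk (t, u) ⟨⟨by simp; linarith, by simp; linarith⟩, hu⟩, one_mul, mul_comm]

lemma IsConvolution.apply_crossCorr_iota {Z : Distrib} {ζ η : TestFn}
    (h : IsConvolution Z (iota ζ) (iota η)) (φ : TestFn) :
    Z (crossCorr ζ φ) = ∫ x, η x * φ x := by
  simp only [h.apply_crossCorr, iota_apply, mul_comm]

/-- The operator `Z *` commutes with convolutions: if it maps `ζ` to `η`, then it maps `ζ * a`
to `η * a`. -/
lemma IsConvolution.eq_conv {Z : Distrib} {ζ η a η' : TestFn}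
    (h : IsConvolution Z (iota ζ) (iota η)) (h' : IsConvolution Z (iota (conv ζ a)) (iota η')) :
    η' = conv η a := by
  refine testFn_eq_of_integral_eq _ _ fun φ => ?_
  rw [← h'.apply_crossCorr_iota, crossCorr_conv, h.apply_crossCorr_iota, integral_mul_eq_crossCorr,
    ← crossCorr_conv, ← integral_mul_eq_crossCorr]

/-! ### Distributions vanish on test functions that are zero near the support -/

/-- The test function `q * φ`. -/
def mulTest (q : ℝ → ℂ) (hq : ContDiff ℝ ∞ q) (φ : TestFn) : TestFn :=
  mkTest (fun x => q x * φ x) (hq.mul (testFn_contDiff φ)) (testFn_hasCompactSupport φ).mul_left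

@[simp] lemma mulTest_apply (q : ℝ → ℂ) (hq : ContDiff ℝ ∞ q) (φ : TestFn) (x : ℝ) :
    mulTest q hq φ x = q x * φ x := rfl

open scoped Manifold in
lemma isVanishingOn_union (U : Distrib) {V₁ V₂ : Set ℝ} (hV₁ : IsOpen V₁) (hV₂ : IsOpen V₂)
    (h₁ : Distribution.IsVanishingOn (fun φ : TestFn => U φ) V₁)
    (h₂ : Distribution.IsVanishingOn (fun φ : TestFn => U φ) V₂) :
    Distribution.IsVanishingOn (fun φ : TestFn => U φ) (V₁ ∪ V₂) := by
  intro f hf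
  have hK : IsClosed (tsupport f \ V₂) := (isClosed_tsupport f).inter hV₂.isClosed_compl
  have hd : Disjoint V₁ᶜ (tsupport f \ V₂) := by
    rw [Set.disjoint_left]
    exact fun x hx hxK => (hf hxK.1).elim hx hxK.2
  obtain ⟨χ, h0, h1, -⟩ := exists_contMDiffMap_zero_one_nhds_of_isClosed 𝓘(ℝ, ℝ) (n := ⊤)
    hV₁.isClosed_compl hK hd
  have hχ : ContDiff ℝ ∞ fun x => (χ x : ℂ) :=
    Complex.ofRealCLM.contDiff.comp χ.contMDiff.contDiff
  have hχ' : ContDiff ℝ ∞ fun x => 1 - (χ x : ℂ) := contDiff_const.sub hχ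
  have hsum : f = mulTest _ hχ f + mulTest _ hχ' f := by
    ext x
    change f x = (χ x : ℂ) * f x + (1 - (χ x : ℂ)) * f x
    ring
  rw [eventually_nhdsSet_iff_forall] at h0 h1
  have e1 : U (mulTest _ hχ f) = 0 := h₁ _ fun x hx => by
    by_contra hxV
    refine notMem_tsupport_iff_eventuallyEq.2 ?_ hx
    filter_upwards [h0 x hxV] with y hy
    simp [hy]
  have e2 : U (mulTest _ hχ' f) = 0 := h₂ _ fun x hx => by
    by_contra hxV
    refine notMem_tsupport_iff_eventuallyEq.2 ?_ hx
    by_cases hxf : x ∈ tsupport f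
    · filter_upwards [h1 x ⟨hxf, hxV⟩] with y hy
      simp [hy]
    · filter_upwards [notMem_tsupport_iff_eventuallyEq.1 hxf] with y hy
      simp [hy]
  change U f = 0
  rw [hsum, map_add, e1, e2, add_zero]

lemma apply_eq_zero_of_eventually_supp (U : Distrib) (f : TestFn)
    (hf : ∀ᶠ x in 𝓝ˢ (supp U), f x = 0) : U f = 0 := by
  have key : ∃ V, IsOpen V ∧ tsupport f ⊆ V ∧
      Distribution.IsVanishingOn (fun φ : TestFn => U φ) V := by
    refine (testFn_hasCompactSupport f).isCompact.induction_on
      (p := fun K => ∃ V, IsOpen V ∧ K ⊆ V ∧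
        Distribution.IsVanishingOn (fun φ : TestFn => U φ) V) ?_ ?_ ?_ ?_
    · refine ⟨∅, isOpen_empty, subset_rfl, fun u hu => ?_⟩
      rw [Set.subset_empty_iff, tsupport_eq_empty_iff] at hu
      have : u = 0 := by ext x; exact congrFun hu x
      simp [this]
    · rintro s t hst ⟨V, hV, htV, h⟩
      exact ⟨V, hV, hst.trans htV, h⟩
    · rintro s t ⟨V, hV, hsV, h⟩ ⟨V', hV', htV', h'⟩
      exact ⟨V ∪ V', hV.union hV', Set.union_subset_union hsV htV',
        isVanishingOn_union U hV hV' h h'⟩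
    · intro x hx
      have hxU : x ∉ supp U := fun hxU =>
        notMem_tsupport_iff_eventuallyEq.2 (eventually_nhdsSet_iff_forall.1 hf x hxU) hx
      obtain ⟨V, h, hV, hxV⟩ := (Distribution.notMem_dsupport_iff x).1 hxU
      exact ⟨V, mem_nhdsWithin_of_mem_nhds (hV.mem_nhds hxV), V, hV, subset_rfl, h⟩
  obtain ⟨V, -, hfV, h⟩ := key
  exact h f hfV

/-! ### Multiplying a Schwartz function by cutoffs -/

/-- If the derivatives of `q k` grow at most linearly, with constants that tend to `0`, then
`q k * g` tends to `0` in the Schwartz space. -/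
lemma tendsto_zero_of_linear_growth {q : ℕ → ℝ → ℂ} {r : ℕ → ℝ} (g : 𝓢(ℝ, ℂ)) (h : ℕ → 𝓢(ℝ, ℂ))
    (hq : ∀ k, ContDiff ℝ ∞ (q k)) (hr : Tendsto r atTop (𝓝 0)) (hr0 : ∀ k, 0 ≤ r k)
    (hb : ∀ n : ℕ, ∃ C : ℝ, 0 ≤ C ∧ ∀ k x, ‖iteratedDeriv n (q k) x‖ ≤ C * r k * (1 + |x|))
    (hh : ∀ k x, h k x = q k x * g x) : Tendsto h atTop (𝓝 0) := by
  rw [(schwartz_withSeminorms ℂ ℝ ℂ).tendsto_nhds]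
  rintro ⟨l, n⟩ ε hε
  choose C hC0 hC using hb
  let M : ℝ := ∑ i ∈ Finset.range (n + 1), n.choose i * C i *
    (SchwartzMap.seminorm ℂ l (n - i) g + SchwartzMap.seminorm ℂ (l + 1) (n - i) g)
  have hbound : ∀ k, SchwartzMap.seminorm ℂ l n (h k) ≤ M * r k := by
    intro k
    refine SchwartzMap.seminorm_le_bound ℂ l n (h k) (mul_nonneg (Finset.sum_nonneg fun i _ =>
      mul_nonneg (mul_nonneg (Nat.cast_nonneg _) (hC0 i)) (by positivity)) (hr0 k)) fun x => ?_
    have e : ⇑(h k) = fun x => q k x * g x := funext (hh k)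
    rw [e]
    refine (mul_le_mul_of_nonneg_left (norm_iteratedFDeriv_mul_le (hq k) (g.smooth ⊤) x
      (n := n) (by exact_mod_cast le_top)) (by positivity)).trans ?_
    rw [Finset.mul_sum, Finset.sum_mul]
    refine Finset.sum_le_sum fun i _ => ?_
    rw [norm_iteratedFDeriv_eq_norm_iteratedDeriv, norm_iteratedFDeriv_eq_norm_iteratedDeriv]
    have h1 := SchwartzMap.le_seminorm' ℂ l (n - i) g x
    have h2 := SchwartzMap.le_seminorm' ℂ (l + 1) (n - i) g x
    calc ‖x‖ ^ l * (n.choose i * ‖iteratedDeriv i (q k) x‖ * ‖iteratedDeriv (n - i) g x‖)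
        ≤ ‖x‖ ^ l * (n.choose i * (C i * r k * (1 + |x|)) * ‖iteratedDeriv (n - i) g x‖) := by
          gcongr
          exact hC i k x
      _ = n.choose i * C i * r k * (|x| ^ l * ‖iteratedDeriv (n - i) g x‖ +
            |x| ^ (l + 1) * ‖iteratedDeriv (n - i) g x‖) := by
          rw [Real.norm_eq_abs]; ring
      _ ≤ n.choose i * C i * r k * (SchwartzMap.seminorm ℂ l (n - i) g +
            SchwartzMap.seminorm ℂ (l + 1) (n - i) g) := by
          have := hC0 i
          have := hr0 k
          gcongr
      _ = _ := by ring
  have hlim : Tendsto (fun k => M * r k) atTop (𝓝 0) := by simpa using hr.const_mul M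
  filter_upwards [hlim.eventually_lt_const hε] with k hk
  rw [sub_zero]
  exact (hbound k).trans_lt hk

/-- A bump function on the line, equal to `1` on `[-1, 1]`. -/
def lineBump : ContDiffBump (0 : ℝ) := ⟨1, 2, one_pos, one_lt_two⟩

lemma norm_lineBump_sub_one_le (y : ℝ) : ‖(lineBump y : ℂ) - 1‖ ≤ |y| := by
  by_cases hy : |y| ≤ 1
  · have : lineBump y = 1 := lineBump.one_of_mem_closedBall (by
      simpa [lineBump] using hy)
    simp [this]
  · have h0 := lineBump.nonneg (x := y)
    have h1 := lineBump.le_one (x := y)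
    rw [← Complex.ofReal_one, ← Complex.ofReal_sub, Complex.norm_real, Real.norm_eq_abs]
    exact (abs_le.2 ⟨by linarith, by linarith⟩).trans (not_le.1 hy).le

/-- The cutoff `x ↦ θ (r x)`, which tends to `1` as `r → 0`. -/
def cutoff (r : ℝ) (hr : 0 < r) : TestFn :=
  mkTest (fun x => (lineBump (r * x) : ℂ))
    (by
      have h : ContDiff ℝ ∞ fun x : ℝ => r * x := contDiff_const.mul contDiff_id
      have h' : ContDiff ℝ ∞ fun x : ℝ => lineBump (r * x) := lineBump.contDiff.comp h
      exact Complex.ofRealCLM.contDiff.comp h')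
    (by
      have h : HasCompactSupport fun x => (lineBump x : ℂ) :=
        lineBump.hasCompactSupport.comp_left Complex.ofReal_zero
      simpa only [smul_eq_mul] using h.comp_smul hr.ne')

@[simp] lemma cutoff_apply (r : ℝ) (hr : 0 < r) (x : ℝ) :
    cutoff r hr x = (lineBump (r * x) : ℂ) := rfl

lemma iteratedDeriv_testFn_contDiff (φ : TestFn) (n : ℕ) : ContDiff ℝ ∞ (iteratedDeriv n φ) :=
  iteratedDeriv_eq_iterate (f := φ) ▸ (testFn_contDiff φ).iterate_deriv n

lemma iteratedDeriv_hasCompactSupport (φ : TestFn) (n : ℕ) :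
    HasCompactSupport (iteratedDeriv n φ) := by
  induction n with
  | zero => simpa using testFn_hasCompactSupport φ
  | succ n ih => rw [iteratedDeriv_succ]; exact ih.deriv

/-- The `n`-th derivative of a test function. -/
def derivTest (n : ℕ) (φ : TestFn) : TestFn :=
  mkTest (iteratedDeriv n φ) (iteratedDeriv_testFn_contDiff φ n)
    (iteratedDeriv_hasCompactSupport φ n)

@[simp] lemma derivTest_apply (n : ℕ) (φ : TestFn) (x : ℝ) :
    derivTest n φ x = iteratedDeriv n φ x := rfl

lemma deriv_crossCorr (f φ : TestFn) : deriv (crossCorr f φ) = crossCorr f (derivTest 1 φ) := by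
  funext t
  have h := ((testFn_hasCompactSupport φ).hasDerivAt_convolution_right
    (ContinuousLinearMap.mul ℝ ℂ) (f₀ := f ∘ Homeomorph.neg ℝ) (μ := volume)
    ((testFn_continuous f).comp continuous_neg).locallyIntegrable
    ((testFn_contDiff φ).of_le (by exact_mod_cast le_top)) t).deriv
  have e : deriv φ = derivTest 1 φ := iteratedDeriv_one.symm
  rw [e, ← correlation_eq_convolution] at h
  exact h.trans (congrFun (correlation_eq_convolution f (derivTest 1 φ)) t).symm

lemma iteratedDeriv_crossCorr (f φ : TestFn) (n : ℕ) :
    iteratedDeriv n (crossCorr f φ) = crossCorr f (derivTest n φ) := by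
  induction n with
  | zero =>
    funext t
    simp
  | succ n ih =>
    rw [iteratedDeriv_succ, ih, deriv_crossCorr]
    funext t
    simp only [crossCorr_apply, derivTest_apply]
    congr 1; ext u
    rw [iteratedDeriv_one, iteratedDeriv_succ]
    rfl

/-- Averaging the cutoffs against `f` gives functions that tend to the constant `∫ f`, in the sense
that is needed for `tendsto_zero_of_linear_growth`. -/
lemma exists_bound_iteratedDeriv_crossCorr_cutoff (f : TestFn) (n : ℕ) : ∃ C : ℝ, 0 ≤ C ∧
    ∀ (r : ℝ) (hr : 0 < r), r ≤ 1 → ∀ x,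
      ‖iteratedDeriv n (fun x => crossCorr f (cutoff r hr) x - ∫ u, f u) x‖
        ≤ C * r * (1 + |x|) := by
  cases n with
  | zero =>
    have hint : Integrable fun u => ‖f u‖ * (1 + |u|) :=
      ((testFn_continuous f).norm.mul (continuous_const.add continuous_abs))
        |>.integrable_of_hasCompactSupport (testFn_hasCompactSupport f).norm.mul_right
    refine ⟨∫ u, ‖f u‖ * (1 + |u|), integral_nonneg fun u => by positivity, fun r hr _ x => ?_⟩
    have hcut : Integrable fun u => f u * cutoff r hr (x + u) :=
      ((testFn_continuous f).mul ((testFn_continuous _).comp (continuous_const.add continuous_id)))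
        |>.integrable_of_hasCompactSupport (testFn_hasCompactSupport f).mul_right
    rw [iteratedDeriv_zero, crossCorr_apply, ← integral_sub hcut (testFn_integrable f), mul_assoc,
      ← integral_mul_const]
    refine norm_integral_le_of_norm_le (hint.mul_const _) (Eventually.of_forall fun u => ?_)
    rw [show f u * cutoff r hr (x + u) - f u = f u * ((lineBump (r * (x + u)) : ℂ) - 1) by
      rw [cutoff_apply]; ring, norm_mul, mul_assoc]
    refine mul_le_mul_of_nonneg_left ((norm_lineBump_sub_one_le _).trans ?_) (norm_nonneg _)
    rw [abs_mul, abs_of_pos hr]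
    have h1 := abs_add_le x u
    have h2 : 0 ≤ |x| * |u| := by positivity
    nlinarith
  | succ n =>
    obtain ⟨C, hC⟩ := (iteratedDeriv_hasCompactSupport (cutoff 1 one_pos) (n + 1))
      |>.exists_bound_of_continuous (iteratedDeriv_testFn_contDiff _ _).continuous
    have hC0 : 0 ≤ C := (norm_nonneg _).trans (hC 0)
    refine ⟨(∫ u, ‖f u‖) * C, mul_nonneg (integral_nonneg fun u => norm_nonneg _) hC0,
      fun r hr hr1 x => ?_⟩
    have hcut : ∀ y, ‖iteratedDeriv (n + 1) (cutoff r hr) y‖ ≤ C * r := by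
      intro y
      have e : ⇑(cutoff r hr) = fun x => cutoff 1 one_pos (r * x) := by
        funext x; simp
      rw [e, iteratedDeriv_comp_const_smul
        ((testFn_contDiff _).of_le (by exact_mod_cast le_top)) r]
      simp only [norm_smul, norm_pow, Real.norm_of_nonneg hr.le]
      rw [mul_comm]
      refine mul_le_mul (hC _) ?_ (by positivity) hC0
      rw [pow_succ]
      exact mul_le_of_le_one_left hr.le (pow_le_one₀ hr.le hr1)
    have e : iteratedDeriv (n + 1) (fun x => crossCorr f (cutoff r hr) x - ∫ u, f u) x
        = crossCorr f (derivTest (n + 1) (cutoff r hr)) x := by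
      rw [← iteratedDeriv_crossCorr, iteratedDeriv_succ', iteratedDeriv_succ']
      congr 1
      funext y
      rw [deriv_sub_const]
    rw [e, crossCorr_apply]
    calc ‖∫ u, f u * derivTest (n + 1) (cutoff r hr) (x + u)‖ ≤ ∫ u, ‖f u‖ * (C * r) := by
          refine norm_integral_le_of_norm_le ((testFn_integrable f).norm.mul_const _)
            (Eventually.of_forall fun u => ?_)
          rw [norm_mul]
          exact mul_le_mul_of_nonneg_left (hcut _) (norm_nonneg _)
      _ = (∫ u, ‖f u‖) * C * r * 1 := by rw [integral_mul_const]; ring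
      _ ≤ _ := by
          have : 0 ≤ ∫ u, ‖f u‖ := integral_nonneg fun u => norm_nonneg _
          gcongr
          linarith [abs_nonneg x]

/-! ### The Laplace transform -/

/-- The Laplace transform of a test function. -/
def laplace (f : TestFn) (s : ℂ) : ℂ := ∫ τ : ℝ, f τ * Complex.exp (-s * τ)

lemma contDiff_cexp_mul (s : ℂ) : ContDiff ℝ ∞ fun τ : ℝ => Complex.exp (s * τ) :=
  (contDiff_const.mul Complex.ofRealCLM.contDiff).cexp

/-- The relation between input and output of the operator `Z *`, on the side of the Laplace
transforms. It is obtained by inserting the truncated exponentials `θ (r t) e^{-st}` in the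
transposed form of the convolution, and letting `r → 0`. -/
lemma IsLaplaceDatum.apply_mul_laplace {Z : Distrib} {s : ℂ} {c : ℝ} {T : 𝓢'(ℝ, ℂ)} {ρ : ℝ → ℂ}
    {g : 𝓢(ℝ, ℂ)} (hd : IsLaplaceDatum Z s c T ρ g) {ζ η : TestFn}
    (h : IsConvolution Z (iota ζ) (iota η)) : T g * laplace ζ s = laplace η s := by
  let r : ℕ → ℝ := fun k => ((k : ℝ) + 1)⁻¹
  have hr : ∀ k, 0 < r k := fun k => by positivity
  have hr1 : ∀ k, r k ≤ 1 := fun k => inv_le_one_of_one_le₀ (by simp)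
  have hr0 : Tendsto r atTop (𝓝 0) := by
    simpa only [one_div] using tendsto_one_div_add_atTop_nhds_zero_nat (𝕜 := ℝ)
  let f : TestFn := mulTest _ (contDiff_cexp_mul (-s)) ζ
  have hf : ∫ u, f u = laplace ζ s := by simp [f, laplace, mul_comm]
  let m : ℕ → TestFn := fun k => crossCorr f (cutoff (r k) (hr k))
  let φ : ℕ → TestFn := fun k => mulTest _ (contDiff_cexp_mul (-s)) (cutoff (r k) (hr k))
  have hφ : ∀ k t, crossCorr ζ (φ k) t = Complex.exp (-s * t) * m k t := by
    intro k t
    simp only [m, φ, f, crossCorr_apply, mulTest_apply, ← integral_const_mul]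
    congr 1; ext u
    rw [Complex.ofReal_add, mul_add, Complex.exp_add]
    ring
  let w : ℕ → TestFn := fun k => mulTest g (g.smooth ⊤) (m k)
  let G : ℕ → 𝓢(ℝ, ℂ) := fun k =>
    (testFn_hasCompactSupport (w k)).toSchwartzMap (testFn_contDiff (w k))
  have hTG : ∀ k, T (G k) = Z (crossCorr ζ (φ k)) := by
    intro k
    rw [hd.extends_exp (w k) (G k) fun x => rfl,
      pairing_of_testFn Z _ (mulTest ρ hd.smooth (crossCorr ζ (φ k)))]
    · rw [← sub_eq_zero, ← map_sub]
      refine apply_eq_zero_of_eventually_supp _ _ ?_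
      filter_upwards [hd.eq_one] with x hx
      change ρ x * crossCorr ζ (φ k) x - crossCorr ζ (φ k) x = 0
      rw [hx]; ring
    · intro x
      change _ * (g x * m k x) = ρ x * crossCorr ζ (φ k) x
      rw [hφ, hd.eq_mul_exp, Complex.ofReal_exp,
        show -s * (x : ℂ) = ((-(c * x) : ℝ) : ℂ) + -(s - c) * x by push_cast; ring,
        Complex.exp_add]
      ring
  have hlim : Tendsto (fun k => G k - laplace ζ s • g) atTop (𝓝 0) := by
    refine tendsto_zero_of_linear_growth (q := fun k x => m k x - laplace ζ s) (r := r) g _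
      (fun k => (testFn_contDiff _).sub contDiff_const) hr0 (fun k => (hr k).le) (fun n => ?_) ?_
    · obtain ⟨C, hC0, hC⟩ := exists_bound_iteratedDeriv_crossCorr_cutoff f n
      rw [hf] at hC
      exact ⟨C, hC0, fun k x => hC (r k) (hr k) (hr1 k) x⟩
    · intro k x
      change g x * m k x - laplace ζ s * g x = _
      ring
  have hleft : Tendsto (fun k => T (G k)) atTop (𝓝 (laplace ζ s * T g)) := by
    have h1 : Tendsto (fun k => T (G k - laplace ζ s • g)) atTop (𝓝 (T 0)) :=
      (T.continuous.tendsto 0).comp hlim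
    have h2 := h1.add_const (laplace ζ s * T g)
    have h3 : ∀ k, T (G k - laplace ζ s • g) = T (G k) - laplace ζ s * T g := fun k =>
      (T.toLinearMap.map_sub _ _).trans (congrArg _ (T.toLinearMap.map_smul _ _))
    have h4 : T 0 = 0 := T.toLinearMap.map_zero
    simpa [h3, h4] using h2
  have hright : ∀ᶠ k in atTop, T (G k) = laplace η s := by
    obtain ⟨M, -, hM⟩ := exists_testFn_bound η
    filter_upwards [eventually_ge_atTop ⌈M⌉₊] with k hk
    have hMk : M ≤ k := Nat.ceil_le.1 hk
    rw [hTG, h.apply_crossCorr_iota, laplace]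
    congr 1; ext x
    by_cases hx : M < |x|
    · simp [hM x hx]
    · have : lineBump (r k * x) = 1 := by
        apply lineBump.one_of_mem_closedBall
        rw [mem_closedBall_zero_iff, norm_mul, Real.norm_of_nonneg (hr k).le]
        change ((k : ℝ) + 1)⁻¹ * |x| ≤ 1
        rw [inv_mul_le_iff₀ (by positivity)]
        linarith
      simp [φ, this]
  rw [mul_comm]
  exact tendsto_nhds_unique hleft (tendsto_const_nhds.congr' (hright.mono fun k hk => hk.symm))

/-! ### Existence and regularity of Laplace transforms -/

lemma iteratedDeriv_const_mul_cexp (n : ℕ) (A s : ℂ) :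
    iteratedDeriv n (fun τ : ℝ => A * Complex.exp (s * τ)) =
      fun τ : ℝ => A * s ^ n * Complex.exp (s * τ) := by
  induction n with
  | zero => simp
  | succ n ih =>
    rw [iteratedDeriv_succ, ih]
    funext τ
    have h1 : HasDerivAt (fun τ : ℝ => s * (τ : ℂ)) (s * 1) τ :=
      (Complex.ofRealCLM.hasDerivAt (x := τ)).const_mul s
    rw [(h1.cexp.const_mul (A * s ^ n)).deriv]
    ring

lemma contDiff_smoothTransition_add (b : ℝ) :
    ContDiff ℝ ∞ fun x : ℝ => (Real.smoothTransition (x + b) : ℂ) := by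
  have h : ContDiff ℝ ∞ fun x : ℝ => x + b := contDiff_id.add contDiff_const
  have h' : ContDiff ℝ ∞ fun x : ℝ => Real.smoothTransition (x + b) :=
    Real.smoothTransition.contDiff.comp h
  exact Complex.ofRealCLM.contDiff.comp h'

lemma pow_mul_exp_neg_le {σ x : ℝ} (hσ : 0 < σ) (hx : 0 ≤ x) (k : ℕ) :
    x ^ k * Real.exp (-(σ * x)) ≤ k.factorial / σ ^ k := by
  have h := Real.pow_div_factorial_le_exp (σ * x) (by positivity) k
  rw [div_le_iff₀ (by positivity)] at h
  rw [le_div_iff₀ (by positivity), Real.exp_neg, mul_right_comm, ← div_eq_mul_inv,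
    div_le_iff₀ (Real.exp_pos _), ← mul_pow, mul_comm x σ, mul_comm (k.factorial : ℝ)]
  exact h

/-- The Schwartz function `ρ ξ * e^{-sξ}`, where `ρ` is a smooth step that is `0` for `ξ ≤ -2`
and `1` for `ξ ≥ -1`. -/
def truncatedExp (s : ℂ) (hs : 0 < s.re) : 𝓢(ℝ, ℂ) where
  toFun ξ := (Real.smoothTransition (ξ + 2) : ℂ) * Complex.exp (-s * ξ)
  smooth' := (contDiff_smoothTransition_add 2).mul (contDiff_cexp_mul (-s))
  decay' k n := by
    set f : ℝ → ℂ := fun ξ => (Real.smoothTransition (ξ + 2) : ℂ) * Complex.exp (-s * ξ) with hf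
    have hsm : ContDiff ℝ ∞ f := (contDiff_smoothTransition_add 2).mul (contDiff_cexp_mul (-s))
    obtain ⟨C, hC⟩ := (isCompact_Icc (a := (-2 : ℝ)) (b := 0)).exists_bound_of_continuousOn
      (f := fun x => ‖x‖ ^ k * ‖iteratedDeriv n f x‖)
      ((continuous_norm.pow k).mul
        (hsm.continuous_iteratedDeriv n (by exact_mod_cast le_top)).norm).continuousOn
    have hC0 : 0 ≤ C := (norm_nonneg _).trans (hC 0 (by simp))
    refine ⟨max C (‖s‖ ^ n * (k.factorial / s.re ^ k)), fun x => ?_⟩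
    rw [norm_iteratedFDeriv_eq_norm_iteratedDeriv]
    rcases lt_or_ge x (-2) with h2 | h2
    · have e : f =ᶠ[𝓝 x] fun _ => 0 := by
        filter_upwards [eventually_lt_nhds h2] with y hy
        simp [hf, Real.smoothTransition.zero_of_nonpos (by linarith : y + 2 ≤ 0)]
      rw [e.iteratedDeriv_eq]
      simp [hC0]
    rcases le_or_gt x 0 with h0 | h0
    · refine le_max_of_le_left ((le_abs_self _).trans ?_)
      exact hC x ⟨h2, h0⟩
    · have e : f =ᶠ[𝓝 x] fun y : ℝ => 1 * Complex.exp (-s * y) := by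
        filter_upwards [eventually_gt_nhds h0] with y hy
        simp [hf, Real.smoothTransition.one_of_one_le (by linarith : 1 ≤ y + 2)]
      rw [e.iteratedDeriv_eq, iteratedDeriv_const_mul_cexp]
      refine le_max_of_le_right ?_
      have h := pow_mul_exp_neg_le hs h0.le k
      simp only [one_mul, norm_mul, norm_pow, norm_neg, Complex.norm_exp,
        Real.norm_of_nonneg h0.le]
      have e2 : (-s * (x : ℂ)).re = -(s.re * x) := by simp
      rw [e2, mul_left_comm]
      gcongr

@[simp] lemma truncatedExp_apply (s : ℂ) (hs : 0 < s.re) (ξ : ℝ) :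
    truncatedExp s hs ξ = (Real.smoothTransition (ξ + 2) : ℂ) * Complex.exp (-s * ξ) := rfl

lemma exists_isLaplaceDatum {Z : Distrib} (hc : IsCausal Z) (hg : HasSlowGrowth Z) {s : ℂ}
    (hs : 0 < s.re) : ∃ c T ρ g, IsLaplaceDatum Z s c T ρ g := by
  obtain ⟨T, hT⟩ := hg
  refine ⟨0, T, fun ξ => (Real.smoothTransition (ξ + 2) : ℂ), truncatedExp s hs, hs, ?_,
    contDiff_smoothTransition_add 2, ⟨-2, ?_⟩, ?_, ?_⟩
  · intro φ g h
    rw [hT φ g h]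
    exact (pairing_of_testFn _ _ _ fun x => by simp).symm
  · intro x hx
    by_contra h
    exact hx (by simp [Real.smoothTransition.zero_of_nonpos (by linarith : x + 2 ≤ 0)])
  · have : Set.Ioi (-1 : ℝ) ∈ 𝓝ˢ (supp Z) :=
      isOpen_Ioi.mem_nhdsSet.2 (hc.trans fun x hx => by
        rw [Set.mem_Ici] at hx
        rw [Set.mem_Ioi]
        linarith)
    filter_upwards [this] with x hx
    rw [Set.mem_Ioi] at hx
    simp [Real.smoothTransition.one_of_one_le (by linarith : 1 ≤ x + 2)]
  · intro ξ
    simp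

lemma differentiable_laplace (f : TestFn) : Differentiable ℂ (laplace f) := by
  intro s
  let bound : ℝ → ℝ := fun τ => ‖f τ‖ * (|τ| * Real.exp ((‖s‖ + 1) * |τ|))
  have hcont : ∀ z : ℂ, Continuous fun τ : ℝ => f τ * Complex.exp (-z * τ) := fun z =>
    (testFn_continuous f).mul (contDiff_cexp_mul (-z)).continuous
  have hcont' : Continuous fun τ : ℝ => f τ * (-τ * Complex.exp (-s * τ)) :=
    (testFn_continuous f).mul
      (Complex.continuous_ofReal.neg.mul (contDiff_cexp_mul (-s)).continuous)
  have hb : Integrable bound :=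
    ((testFn_continuous f).norm.mul (continuous_abs.mul
      (Real.continuous_exp.comp (continuous_const.mul continuous_abs))))
      |>.integrable_of_hasCompactSupport (testFn_hasCompactSupport f).norm.mul_right
  refine (hasDerivAt_integral_of_dominated_loc_of_deriv_le
    (F := fun (z : ℂ) (τ : ℝ) => f τ * Complex.exp (-z * τ))
    (F' := fun (z : ℂ) (τ : ℝ) => f τ * (-τ * Complex.exp (-z * τ)))
    (Metric.ball_mem_nhds s one_pos) (Eventually.of_forall fun z => (hcont z).aestronglyMeasurable)
    ((hcont s).integrable_of_hasCompactSupport (testFn_hasCompactSupport f).mul_right)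
    hcont'.aestronglyMeasurable
    (Eventually.of_forall fun τ z hz => ?_) hb
    (Eventually.of_forall fun τ z hz => ?_)).2.differentiableAt
  · rw [norm_mul, norm_mul, norm_neg, Complex.norm_real, Real.norm_eq_abs, Complex.norm_exp]
    have hz' : ‖z‖ ≤ ‖s‖ + 1 := by
      have := norm_le_norm_add_norm_sub' z s
      have := mem_ball_iff_norm.1 hz
      linarith
    have : (-z * (τ : ℂ)).re ≤ (‖s‖ + 1) * |τ| := by
      refine (Complex.re_le_norm _).trans ?_
      rw [norm_mul, norm_neg, Complex.norm_real, Real.norm_eq_abs]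
      exact mul_le_mul_of_nonneg_right hz' (abs_nonneg _)
    exact mul_le_mul_of_nonneg_left (mul_le_mul_of_nonneg_left (Real.exp_le_exp.2 this)
      (abs_nonneg _)) (norm_nonneg _)
  · have h1 : HasDerivAt (fun z : ℂ => -z * (τ : ℂ)) (-1 * τ) z :=
      (hasDerivAt_id z).neg.mul_const _
    have h2 := h1.cexp.const_mul (f τ)
    rwa [neg_one_mul, mul_comm (Complex.exp _)] at h2

/-- A bump function multiplied by `e^{sτ}`; its Laplace transform at `s` is the integral of the
bump function. -/
def expBump (s : ℂ) : TestFn := mulTest _ (contDiff_cexp_mul s) (cutoff 1 one_pos)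

lemma expBump_apply (s : ℂ) (x : ℝ) : expBump s x = Complex.exp (s * x) * lineBump x := by
  simp [expBump]

lemma laplace_expBump_ne_zero (s : ℂ) : laplace (expBump s) s ≠ 0 := by
  have h : laplace (expBump s) s = ((∫ x, lineBump x : ℝ) : ℂ) := by
    rw [laplace, ← integral_complex_ofReal]
    congr 1; ext x
    rw [expBump_apply, mul_right_comm, ← Complex.exp_add]
    simp
  rw [h]
  exact_mod_cast lineBump.integral_pos.ne'

lemma im_laplace_eq_zero (f : TestFn) (hf : ∀ x, (f x).im = 0) (x : ℝ) :
    (laplace f x).im = 0 := by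
  have h : laplace f x = ((∫ τ : ℝ, (f τ).re * Real.exp (-x * τ) : ℝ) : ℂ) := by
    rw [laplace, ← integral_complex_ofReal]
    congr 1; ext τ
    push_cast
    congr 1
    exact Complex.ext (by simp) (by simp [hf])
  rw [h, Complex.ofReal_im]

/-- A test function that is a real distribution has real values. -/
lemma im_eq_zero_of_isRealDistrib_iota {η : TestFn} (h : IsRealDistrib (iota η)) (x : ℝ) :
    (η x).im = 0 := by
  -- Test the distribution on the imaginary part of `η` itself.
  have h1 : ContDiff ℝ ∞ fun x => ((η x).im : ℂ) :=
    Complex.ofRealCLM.contDiff.comp (Complex.imCLM.contDiff.comp (testFn_contDiff η))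
  have h2 : HasCompactSupport fun x => ((η x).im : ℂ) :=
    (testFn_hasCompactSupport η).comp_left (g := fun z : ℂ => ((z.im : ℝ) : ℂ)) (by simp)
  let φ := mkTest _ h1 h2
  have h3 := h φ fun x => by simp [φ]
  have hint : Integrable fun x => φ x * η x :=
    ((testFn_continuous φ).mul (testFn_continuous η)).integrable_of_hasCompactSupport
      (testFn_hasCompactSupport η).mul_left
  rw [iota_apply] at h3
  have h4 : (∫ x, φ x * η x).im = ∫ x, (φ x * η x).im :=
    (Complex.imCLM.integral_comp_comm hint).symm
  have h5 : ∀ x, (φ x * η x).im = (η x).im ^ 2 := fun x => by simp [φ, sq]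
  simp only [h4, h5] at h3
  have hc : Continuous fun x => (η x).im ^ 2 :=
    (Complex.continuous_im.comp (testFn_continuous η)).pow 2
  have h6 : Integrable fun x => (η x).im ^ 2 := by
    have : Integrable fun x => (φ x * η x).im := Complex.imCLM.integrable_comp hint
    simpa only [h5] using this
  rw [integral_eq_zero_iff_of_nonneg (fun x => sq_nonneg _) h6] at h3
  have := congrFun ((hc.ae_eq_iff_eq volume continuous_const).1 h3) x
  exact pow_eq_zero_iff two_ne_zero |>.1 this

/-! ### The energy inequality for exponential inputs -/

/-- The integrand of the energy inequality, for an input `x` and an output `y`. -/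
def energyDensity {N : ℕ} (F G : Fin (N + 1) → ℝ) (x y : ℝ → ℂ) (τ : ℝ) : ℝ :=
  ∑ j : Fin (N + 1),
      ((kron j - F j) * ‖iteratedDeriv j x τ‖ ^ 2 - (kron j + F j) * ‖iteratedDeriv j y τ‖ ^ 2)
    - 2 * ∑ j : Fin (N + 1), G j * (conj (iteratedDeriv j x τ) * iteratedDeriv j y τ).re

lemma integrable_sq_norm_testFn (φ : TestFn) : Integrable fun τ => ‖φ τ‖ ^ 2 := by
  have h : HasCompactSupport fun τ => ‖φ τ‖ ^ 2 :=
    (testFn_hasCompactSupport φ).comp_left (g := fun z : ℂ => ‖z‖ ^ 2) (by simp)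
  exact ((testFn_continuous φ).norm.pow 2).integrable_of_hasCompactSupport h

lemma integrable_conj_mul_testFn (φ ψ : TestFn) : Integrable fun τ => conj (φ τ) * ψ τ :=
  ((Complex.continuous_conj.comp (testFn_continuous φ)).mul
    (testFn_continuous ψ)).integrable_of_hasCompactSupport (testFn_hasCompactSupport ψ).mul_left

lemma integrable_energyDensity {N : ℕ} (F G : Fin (N + 1) → ℝ) (ζ η : TestFn) :
    Integrable (energyDensity F G ζ η) :=
  (integrable_finsetSum _ fun (j : Fin (N + 1)) _ =>
    ((integrable_sq_norm_testFn (derivTest j ζ)).const_mul _).sub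
      ((integrable_sq_norm_testFn (derivTest j η)).const_mul _)).sub
  ((integrable_finsetSum _ fun (j : Fin (N + 1)) _ =>
    (Complex.reCLM.integrable_comp
      (integrable_conj_mul_testFn (derivTest j ζ) (derivTest j η))).const_mul (G j)).const_mul 2)

lemma setIntegral_energyDensity {N : ℕ} (F G : Fin (N + 1) → ℝ) (ζ η : TestFn) (t : ℝ) :
    ∫ τ in Set.Iic t, energyDensity F G ζ η τ =
      (∑ j : Fin (N + 1), ∫ τ in Set.Iic t,
        ((kron j - F j) * ‖iteratedDeriv j ζ τ‖ ^ 2 - (kron j + F j) * ‖iteratedDeriv j η τ‖ ^ 2))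
      - 2 * ∑ j : Fin (N + 1),
          G j * (∫ τ in Set.Iic t, conj (iteratedDeriv j ζ τ) * iteratedDeriv j η τ).re := by
  have h1 : ∀ j : Fin (N + 1), IntegrableOn (fun τ => (kron j - F j) * ‖iteratedDeriv j ζ τ‖ ^ 2 -
      (kron j + F j) * ‖iteratedDeriv j η τ‖ ^ 2) (Set.Iic t) := fun j =>
    (((integrable_sq_norm_testFn (derivTest j ζ)).const_mul _).sub
      ((integrable_sq_norm_testFn (derivTest j η)).const_mul _)).integrableOn
  have h2 : ∀ j : Fin (N + 1), IntegrableOn (fun τ =>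
      conj (iteratedDeriv j ζ τ) * iteratedDeriv j η τ) (Set.Iic t) := fun j =>
    (integrable_conj_mul_testFn (derivTest j ζ) (derivTest j η)).integrableOn
  have h3 : ∀ j : Fin (N + 1), IntegrableOn (fun τ =>
      G j * (conj (iteratedDeriv j ζ τ) * iteratedDeriv j η τ).re) (Set.Iic t) := fun j =>
    Integrable.const_mul (Complex.reCLM.integrable_comp (h2 j)) _
  unfold energyDensity
  rw [integral_sub (integrable_finsetSum _ fun j _ => h1 j)
    ((integrable_finsetSum _ fun j _ => h3 j).const_mul 2),
    integral_finsetSum _ fun j _ => h1 j, integral_const_mul,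
    integral_finsetSum _ fun j _ => h3 j]
  congr 2
  refine Finset.sum_congr rfl fun j _ => ?_
  rw [integral_const_mul]
  exact congrArg _ (Complex.reCLM.integral_comp_comm (h2 j))

/-- If the integrals of `f` over all half-lines `(-∞, t]` are nonnegative and `f` is eventually a
multiple of a growing exponential, then the factor is nonnegative. -/
lemma nonneg_of_setIntegral_Iic_nonneg {f : ℝ → ℝ} {c k t₀ : ℝ} (hk : 0 < k)
    (hint : ∀ t, IntegrableOn f (Set.Iic t)) (h : ∀ t, 0 ≤ ∫ τ in Set.Iic t, f τ)
    (hf : ∀ τ, t₀ < τ → f τ = c * Real.exp (k * τ)) : 0 ≤ c := by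
  by_contra! hc
  set I := ∫ τ in Set.Iic t₀, f τ
  have hexp : Tendsto (fun t : ℝ => Real.exp (k * t)) atTop atTop :=
    Real.tendsto_exp_atTop.comp (tendsto_id.const_mul_atTop hk)
  obtain ⟨t, ht, ht₀⟩ := ((hexp.eventually_gt_atTop (Real.exp (k * t₀) + I * k / (-c))).and
    (eventually_ge_atTop t₀)).exists
  have h1 : ∫ τ in t₀..t, f τ = c / k * (Real.exp (k * t) - Real.exp (k * t₀)) := by
    rw [intervalIntegral.integral_congr_ae (g := fun τ => c * Real.exp (k * τ))
      (Eventually.of_forall fun τ hτ => hf τ (by rw [Set.uIoc_of_le ht₀] at hτ; exact hτ.1)),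
      intervalIntegral.integral_eq_sub_of_hasDerivAt (f := fun τ => c / k * Real.exp (k * τ))]
    · ring
    · intro τ _
      have : HasDerivAt (fun τ => k * τ) (k * 1) τ := (hasDerivAt_id τ).const_mul k
      refine (this.exp.const_mul (c / k)).congr_deriv ?_
      field_simp
    · exact Continuous.intervalIntegrable (by fun_prop) _ _
  have h2 := intervalIntegral.integral_Iic_sub_Iic (hint t₀) (hint t)
  have h3 := h t
  rw [h1] at h2
  have h4 : I * k / (-c) < Real.exp (k * t) - Real.exp (k * t₀) := by linarith
  rw [div_lt_iff₀ (by linarith)] at h4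
  have h5 : c / k * (Real.exp (k * t) - Real.exp (k * t₀)) * k =
      -((Real.exp (k * t) - Real.exp (k * t₀)) * -c) := by field_simp
  nlinarith

/-- The exponential `e^{sτ}`, switched on smoothly between `0` and `1`. -/
def switchedExp (s : ℂ) (τ : ℝ) : ℂ := (Real.smoothTransition τ : ℂ) * Complex.exp (s * τ)

/-- The function `switchedExp s`, switched off smoothly between `b - 1` and `b`. -/
def switchedExpTest (s : ℂ) (b : ℝ) : TestFn :=
  mkTest (fun τ => (Real.smoothTransition (b - τ) : ℂ) * switchedExp s τ)
    (by
      have h1 : ContDiff ℝ ∞ fun τ : ℝ => b - τ := contDiff_const.sub contDiff_id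
      have h2 : ContDiff ℝ ∞ fun τ : ℝ => Real.smoothTransition (b - τ) :=
        Real.smoothTransition.contDiff.comp h1
      have h3 : ContDiff ℝ ∞ fun τ : ℝ => (Real.smoothTransition τ : ℂ) := by
        simpa using contDiff_smoothTransition_add 0
      exact (Complex.ofRealCLM.contDiff.comp h2).mul (h3.mul (contDiff_cexp_mul s)))
    (HasCompactSupport.intro (isCompact_Icc (a := 0) (b := b)) fun τ hτ => by
      rw [Set.mem_Icc, not_and_or, not_le, not_le] at hτ
      rcases hτ with h | h
      · simp [switchedExp, Real.smoothTransition.zero_of_nonpos h.le]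
      · simp [Real.smoothTransition.zero_of_nonpos (by linarith : b - τ ≤ 0)])

lemma switchedExpTest_apply (s : ℂ) (b τ : ℝ) :
    switchedExpTest s b τ = (Real.smoothTransition (b - τ) : ℂ) * switchedExp s τ := rfl

/-- The response `f * switchedExp s` of a test function `f` to the switched exponential. -/
def expResponse (f : TestFn) (s : ℂ) (τ : ℝ) : ℂ := ∫ u, f u * switchedExp s (τ - u)

/-- Up to time `t` the response does not depend on what the input is far in the future. -/
lemma iteratedDeriv_conv_switchedExpTest {f : TestFn} {M : ℝ} (hM : ∀ x, M < |x| → f x = 0) (s : ℂ)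
    {t τ : ℝ} (hτ : τ ≤ t) (n : ℕ) :
    iteratedDeriv n (conv f (switchedExpTest s (t + M + 2))) τ =
      iteratedDeriv n (expResponse f s) τ := by
  refine Filter.EventuallyEq.iteratedDeriv_eq n ?_
  filter_upwards [eventually_lt_nhds (show τ < t + 1 by linarith)] with y hy
  rw [conv_apply, expResponse]
  congr 1; ext u
  by_cases hu : M < |u|
  · simp [hM u hu]
  · have := abs_le.1 (not_lt.1 hu)
    rw [switchedExpTest_apply, Real.smoothTransition.one_of_one_le (by linarith)]
    simp

/-- Once the switching is outside the window of `f`, the response is exactly exponential. -/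
lemma iteratedDeriv_expResponse {f : TestFn} {M : ℝ} (hM : ∀ x, M < |x| → f x = 0) (s : ℂ)
    {τ : ℝ} (hτ : M + 1 < τ) (n : ℕ) :
    iteratedDeriv n (expResponse f s) τ = laplace f s * s ^ n * Complex.exp (s * τ) := by
  have e : expResponse f s =ᶠ[𝓝 τ] fun y : ℝ => laplace f s * Complex.exp (s * y) := by
    filter_upwards [eventually_gt_nhds hτ] with y hy
    rw [laplace, ← integral_mul_const, expResponse]
    congr 1; ext u
    by_cases hu : M < |u|
    · simp [hM u hu]
    · have := abs_le.1 (not_lt.1 hu)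
      rw [switchedExp, Real.smoothTransition.one_of_one_le (by linarith), Complex.ofReal_one,
        one_mul, mul_assoc, ← Complex.exp_add]
      congr 2
      push_cast
      ring
  rw [e.iteratedDeriv_eq, iteratedDeriv_const_mul_cexp]

/-- The value at `s` of the quadratic form of the energy inequality, for an input with amplitude
`A` and an output with amplitude `B`. -/
def energyForm {N : ℕ} (F G : Fin (N + 1) → ℝ) (s A B : ℂ) : ℝ :=
  ∑ j : Fin (N + 1), ‖s‖ ^ (2 * (j : ℕ)) * ((kron j - F j) * ‖A‖ ^ 2 - (kron j + F j) * ‖B‖ ^ 2)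
    - 2 * ∑ j : Fin (N + 1), G j * ‖s‖ ^ (2 * (j : ℕ)) * (conj A * B).re

lemma energyDensity_of_exp {N : ℕ} (F G : Fin (N + 1) → ℝ) {s A B : ℂ} {x y : ℝ → ℂ} {τ : ℝ}
    (hx : ∀ n, iteratedDeriv n x τ = A * s ^ n * Complex.exp (s * τ))
    (hy : ∀ n, iteratedDeriv n y τ = B * s ^ n * Complex.exp (s * τ)) :
    energyDensity F G x y τ = energyForm F G s A B * Real.exp (2 * s.re * τ) := by
  have hexp : ‖Complex.exp (s * τ)‖ ^ 2 = Real.exp (2 * s.re * τ) := by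
    rw [Complex.norm_exp, ← Real.exp_nat_mul]
    congr 1
    simp
    ring
  have hn : ∀ (D : ℂ) (n : ℕ), ‖D * s ^ n * Complex.exp (s * τ)‖ ^ 2 =
      ‖D‖ ^ 2 * ‖s‖ ^ (2 * n) * Real.exp (2 * s.re * τ) := fun D n => by
    rw [← hexp, norm_mul, norm_mul, norm_pow]
    ring
  have hre : ∀ n : ℕ, (conj (A * s ^ n * Complex.exp (s * τ)) *
      (B * s ^ n * Complex.exp (s * τ))).re =
      (conj A * B).re * ‖s‖ ^ (2 * n) * Real.exp (2 * s.re * τ) := fun n => by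
    have h : conj (A * s ^ n * Complex.exp (s * τ)) * (B * s ^ n * Complex.exp (s * τ)) =
        (conj A * B) * ((‖s‖ ^ (2 * n) * Real.exp (2 * s.re * τ) : ℝ) : ℂ) := by
      rw [← hexp, pow_mul]
      push_cast
      rw [← Complex.conj_mul', ← Complex.conj_mul']
      simp only [map_mul, map_pow]
      ring
    rw [h, Complex.re_mul_ofReal, ← mul_assoc]
  simp only [energyDensity, energyForm, hx, hy, hn, hre]
  rw [sub_mul, Finset.sum_mul, mul_assoc 2 (Finset.sum _ _), Finset.sum_mul]
  congr 1
  · exact Finset.sum_congr rfl fun j _ => by ring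
  · congr 1
    exact Finset.sum_congr rfl fun j _ => by ring

/-- The energy inequality in the frequency domain: apply the inequality to `ζ * a`, where `a` is a
truncation of `switchedExp s`. For large times input and output are exactly exponential, and their
contribution dominates the integrals as `t → ∞`. -/
lemma energyForm_laplace_nonneg {Z : Distrib} {N : ℕ} {F G : Fin (N + 1) → ℝ}
    (hZ : IsScatteringPseudoPassive Z N F G) {ζ η : TestFn}
    (h : IsConvolution Z (iota ζ) (iota η)) {s : ℂ} (hs : 0 < s.re) :
    0 ≤ energyForm F G s (laplace ζ s) (laplace η s) := by
  obtain ⟨M₁, -, hM₁⟩ := exists_testFn_bound ζ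
  obtain ⟨M₂, -, hM₂⟩ := exists_testFn_bound η
  set M := max M₁ M₂
  have hζ : ∀ x, M < |x| → ζ x = 0 := fun x hx => hM₁ x ((le_max_left _ _).trans_lt hx)
  have hη : ∀ x, M < |x| → η x = 0 := fun x hx => hM₂ x ((le_max_right _ _).trans_lt hx)
  have key : ∀ t, Set.EqOn
      (energyDensity F G (conv ζ (switchedExpTest s (t + M + 2)))
        (conv η (switchedExpTest s (t + M + 2))))
      (energyDensity F G (expResponse ζ s) (expResponse η s)) (Set.Iic t) := fun t τ hτ => by
    simp only [energyDensity, iteratedDeriv_conv_switchedExpTest hζ s hτ,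
      iteratedDeriv_conv_switchedExpTest hη s hτ]
  refine nonneg_of_setIntegral_Iic_nonneg (f := energyDensity F G (expResponse ζ s)
    (expResponse η s)) (k := 2 * s.re) (t₀ := M + 1) (by linarith) (fun t => ?_) (fun t => ?_)
    fun τ hτ => energyDensity_of_exp F G (iteratedDeriv_expResponse hζ s hτ)
      (iteratedDeriv_expResponse hη s hτ)
  · exact (integrable_energyDensity F G _ _).integrableOn.congr_fun (key t) measurableSet_Iic
  · obtain ⟨η', h', hpp⟩ := hZ (conv ζ (switchedExpTest s (t + M + 2)))
    obtain rfl := h.eq_conv h'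
    rw [← setIntegral_congr_fun measurableSet_Iic (key t), setIntegral_energyDensity]
    linarith [hpp t]

lemma energyForm_mul {N : ℕ} (F G : Fin (N + 1) → ℝ) (s A w : ℂ) :
    energyForm F G s A (w * A) = energyForm F G s 1 w * ‖A‖ ^ 2 := by
  have hre : (conj A * (w * A)).re = w.re * ‖A‖ ^ 2 := by
    rw [show conj A * (w * A) = w * ((‖A‖ ^ 2 : ℝ) : ℂ) by
      push_cast
      rw [← Complex.conj_mul']
      ring, Complex.re_mul_ofReal]
  simp only [energyForm, hre, norm_mul, map_one, one_mul, norm_one]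
  rw [sub_mul, Finset.sum_mul, mul_assoc 2 (Finset.sum _ _), Finset.sum_mul]
  congr 1
  · exact Finset.sum_congr rfl fun j _ => by ring
  · congr 1
    exact Finset.sum_congr rfl fun j _ => by ring

end ScatteringOperators

end

open ScatteringOperators in
theorem mainTheorem3 (Z : Distrib) (N : ℕ) (F G : Fin (N + 1) → ℝ)
    (hZ : IsScatteringPseudoPassiveCausalSlowGrowth Z N F G) :
    ∃ W : ℂ → ℂ,
      (∀ s ∈ rightHalfPlane, HasLaplaceTransformAt Z s (W s)) ∧
      DifferentiableOn ℂ W rightHalfPlane ∧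
      (∀ s ∈ rightHalfPlane,
        ∑ j : Fin (N + 1), ‖s‖ ^ (2 * (j : ℕ)) *
            ((kron j - F j) - (kron j + F j) * ‖W s‖ ^ 2)
          ≥ 2 * ∑ j : Fin (N + 1), G j * ‖s‖ ^ (2 * (j : ℕ)) * (W s).re) ∧
      (IsRealOperator Z → ∀ x : ℝ, 0 < x → (W x).im = 0) := by
  obtain ⟨hpp, hc, hg⟩ := hZ
  choose η hη _ using fun s : ℂ => hpp (expBump s)
  let W : ℂ → ℂ := fun s => laplace (η s) s / laplace (expBump s) s
  have hval : ∀ s c T ρ g, IsLaplaceDatum Z s c T ρ g → T g = W s := fun s c T ρ g hd =>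
    eq_div_of_mul_eq (laplace_expBump_ne_zero s) (hd.apply_mul_laplace (hη s))
  have hW : ∀ s, 0 < s.re → ∀ ζ η : TestFn, IsConvolution Z (iota ζ) (iota η) →
      W s * laplace ζ s = laplace η s := by
    intro s hs ζ η h
    obtain ⟨c, T, ρ, g, hd⟩ := exists_isLaplaceDatum hc hg hs
    rw [← hval s c T ρ g hd, hd.apply_mul_laplace h]
  refine ⟨W, fun s hs => ⟨⟨0, hc⟩, exists_isLaplaceDatum hc hg hs, hval s⟩, fun s hs => ?_,
    fun s hs => ?_, fun hreal x hx => ?_⟩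
  · -- Near `s`, the quotient `W` can be computed with the input that was chosen for `s`.
    refine DifferentiableAt.differentiableWithinAt ?_
    have hopen : ∀ᶠ z in 𝓝 s, 0 < z.re :=
      Complex.continuous_re.continuousAt.eventually_const_lt hs
    have hne : ∀ᶠ z in 𝓝 s, laplace (expBump s) z ≠ 0 :=
      (differentiable_laplace _ s).continuousAt.eventually_ne (laplace_expBump_ne_zero s)
    refine DifferentiableAt.congr_of_eventuallyEq
      ((differentiable_laplace (η s) s).div (differentiable_laplace (expBump s) s)
        (laplace_expBump_ne_zero s)) ?_
    filter_upwards [hopen, hne] with z hz hz'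
    exact eq_div_of_mul_eq hz' (hW z hz _ _ (hη s))
  · have h := energyForm_laplace_nonneg hpp (hη s) hs
    rw [← hW s hs _ _ (hη s), energyForm_mul] at h
    have hpos : 0 < ‖laplace (expBump s) s‖ ^ 2 := by
      have := norm_pos_iff.2 (laplace_expBump_ne_zero s)
      positivity
    have h' := nonneg_of_mul_nonneg_left h hpos
    simp only [energyForm, norm_one, one_pow, mul_one, map_one, one_mul] at h'
    linarith
  · have hζ : ∀ y, (expBump (x : ℂ) y).im = 0 := fun y => by
      rw [expBump_apply, ← Complex.ofReal_mul, ← Complex.ofReal_exp, ← Complex.ofReal_mul,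
        Complex.ofReal_im]
    have hζreal : IsRealDistrib (iota (expBump (x : ℂ))) := fun φ hφ => by
      have e : iota (expBump (x : ℂ)) φ =
          ((∫ y, (φ y).re * (expBump (x : ℂ) y).re : ℝ) : ℂ) := by
        rw [iota_apply, ← integral_complex_ofReal]
        congr 1; ext y
        exact Complex.ext (by simp [hφ, hζ]) (by simp [hφ, hζ])
      rw [e, Complex.ofReal_im]
    have h1 := im_laplace_eq_zero _ hζ x
    have h2 := im_laplace_eq_zero _
      (im_eq_zero_of_isRealDistrib_iota (hreal _ _ (hη x) hζreal)) x
    change (laplace (η x) x / laplace (expBump x) x).im = 0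
    rw [Complex.div_im, h1, h2]
    simp
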